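/- Let $(R,\mathfrak m)$ be either a Noetherian local ring with maximal ideal $\mathfrak m$, or a standard graded algebra $R=\bigoplus_{n\ge 0}R_n$ over a field $K$ (that is, $R_0=K$, $\dim_K R_1<\infty$, and $R$ is generated by $R_1$ as a $K$-algebra) with graded maximal ideal $\mathfrak m=\bigoplus_{n>0}R_n$. Let $I\subseteq\mathfrak m$ be an ideal, which in the graded case is assumed to be graded. For a finitely generated $R$-module $M$ and a submodule $N\subseteq M$ let $\rho(N,M)$ (the Artin–Rees number) be the smallest integer $r\ge 0$ such that $$N\cap\mathfrak m^iM=\mathfrak m^{i-r}(N\cap\mathfrak m^rM)\qquad\text{for all } i\ge r .$$ For an ideal $J$ of $R$ (graded in the graded case) let $\cdots\to F_2\xrightarrow{\varphi_2}F_1\xrightarrow{\varphi_1}F_0\to J\to 0$ be a minimal free resolution of $J$ by free modules of finite rank (a graded one in the graded case), where minimal means $\varphi_j(F_j)\subseteq\mathfrak mF_{j-1}$ for all $j\ge1$. For $j\ge 1$ put $\rho_j(J)=\rho(\operatorname{Im}\varphi_j,F_{j-1})$; this does not depend on the choice of the minimal resolution. Then for every $j\ge 1$ there exists an integer $c_j$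 such that $\rho_j(I^k)=c_j$ for all $k\gg 0$. Moreover, if $R$ is regular, then there exists an integer $c$ such that $\rho_j(I^k)\le c$ for all $j\ge 1$ and all $k\ge 0$. -/

import Mathlib

section ArtinRees

/-- The natural numbers `r` with `N ∩ 𝔪 ^ i M = 𝔪 ^ (i - r) (N ∩ 𝔪 ^ r M)` for all `i ≥ r`. -/
def artinReesSet {R M : Type*} [CommRing R] [AddCommGroup M] [Module R M]
    (𝔪 : Ideal R) (N : Submodule R M) : Set ℕ :=
  {r | ∀ i, r ≤ i →
    N ⊓ 𝔪 ^ i • (⊤ : Submodule R M) = 𝔪 ^ (i - r) • (N ⊓ 𝔪 ^ r • (⊤ : Submodule R M))}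

/-- The Artin–Rees number `ρ(N, M)` with respect to `𝔪`: the smallest `r` such that
`N ∩ 𝔪 ^ i M = 𝔪 ^ (i - r) (N ∩ 𝔪 ^ r M)` for all `i ≥ r`. -/
noncomputable def artinReesNumber {R M : Type*} [CommRing R] [AddCommGroup M] [Module R M]
    (𝔪 : Ideal R) (N : Submodule R M) : ℕ :=
  sInf (artinReesSet 𝔪 N)

/-- Over a Noetherian ring the Artin–Rees number of a submodule of a finite module is a genuine
minimum, by the Artin–Rees lemma. -/
theorem isLeast_artinReesNumber {R M : Type*} [CommRing R] [IsNoetherianRing R]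
    [AddCommGroup M] [Module R M] [Module.Finite R M] (𝔪 : Ideal R) (N : Submodule R M) :
    IsLeast (artinReesSet 𝔪 N) (artinReesNumber 𝔪 N) := by
  have hne : (artinReesSet 𝔪 N).Nonempty := by
    obtain ⟨r, hr⟩ := Ideal.exists_pow_inf_eq_pow_smul 𝔪 N
    refine ⟨r, fun i hi => ?_⟩
    rw [inf_comm, hr i hi, inf_comm]
  exact ⟨Nat.sInf_mem hne, fun _ h => Nat.sInf_le h⟩

end ArtinRees

/-- A minimal free resolution (with respect to the ideal `𝔪`) of the `R`-module `M` by free modules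
of finite rank, written in bases: an exact sequence
`⋯ → R ^ (rank 2) → R ^ (rank 1) → R ^ (rank 0) → M → 0`
in which every map `R ^ (rank (i + 1)) → R ^ (rank i)` has its image in `𝔪 R ^ (rank i)`. -/
structure MinimalFreeResolution {R : Type*} [CommRing R] (𝔪 : Ideal R)
    (M : Type*) [AddCommGroup M] [Module R M] where
  /-- the rank of the free module `F_i` -/
  rank : ℕ → ℕ
  /-- the augmentation `F_0 → M` -/
  aug : (Fin (rank 0) → R) →ₗ[R] M
  /-- `d i` is the differential `φ_{i+1} : F_{i+1} → F_i` -/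
  d : ∀ i : ℕ, (Fin (rank (i + 1)) → R) →ₗ[R] (Fin (rank i) → R)
  aug_surjective : Function.Surjective aug
  exact_aug : Function.Exact (d 0) aug
  exact_d : ∀ i, Function.Exact (d (i + 1)) (d i)
  minimal : ∀ i, LinearMap.range (d i) ≤ 𝔪 • (⊤ : Submodule R (Fin (rank i) → R))

namespace MinimalFreeResolution

/-- For `j ≥ 1`, the `j`-th syzygy module `N_j = Im (φ_j : F_j → F_{j-1})`, a submodule of
`F_{j-1}`. -/
def syzygy {R : Type*} [CommRing R] {𝔪 : Ideal R} {M : Type*} [AddCommGroup M] [Module R M]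
    (F : MinimalFreeResolution 𝔪 M) (j : ℕ) : Submodule R (Fin (F.rank (j - 1)) → R) :=
  LinearMap.range (F.d (j - 1))

/-- For `j ≥ 1`, the Artin–Rees number `ρ(N_j, F_{j-1})` of the `j`-th syzygy module. -/
noncomputable def rho {R : Type*} [CommRing R] {𝔪 : Ideal R} {M : Type*} [AddCommGroup M]
    [Module R M] (F : MinimalFreeResolution 𝔪 M) (j : ℕ) : ℕ :=
  artinReesNumber 𝔪 (F.syzygy j)

end MinimalFreeResolution

section Graded

/-- A standard graded `K`-algebra `R = ⨁_{n ≥ 0} 𝒜 n`: a nonzero graded `K`-algebra with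
`𝒜 0 = K` that is generated over `K` by its degree one part, which has finite dimension. -/
structure IsStandardGraded {K R : Type*} [Field K] [CommRing R] [Algebra K R]
    (𝒜 : ℕ → Submodule K R) [GradedAlgebra 𝒜] : Prop where
  nontrivial : Nontrivial R
  degree_zero : 𝒜 0 = 1
  generated : Algebra.adjoin K (𝒜 1 : Set R) = ⊤
  finite : Module.Finite K (𝒜 1)

/-- The homogeneous component of integral degree; it vanishes in negative degrees. -/
def intComponent {K R : Type*} [Field K] [CommRing R] [Algebra K R] (𝒜 : ℕ → Submodule K R) :
    ℤ → Submodule K R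
  | Int.ofNat n => 𝒜 n
  | Int.negSucc _ => ⊥

/-- A minimal free resolution of a graded ideal `J` is graded if the basis vectors of the free
modules can be given degrees (that is, `F_i = ⨁_l R(-shift i l)`) such that the augmentation
`F_0 → J` and all differentials `F_{i+1} → F_i` are homogeneous of degree zero. -/
def MinimalFreeResolution.IsGraded {K R : Type*} [Field K] [CommRing R] [Algebra K R]
    (𝒜 : ℕ → Submodule K R) {𝔪 : Ideal R} {J : Ideal R} (F : MinimalFreeResolution 𝔪 J) : Prop :=
  ∃ shift : ∀ i : ℕ, Fin (F.rank i) → ℤ,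
    (∀ l, (F.aug (Pi.single l 1) : R) ∈ intComponent 𝒜 (shift 0 l)) ∧
    ∀ i l l', F.d i (Pi.single l 1) l' ∈ intComponent 𝒜 (shift (i + 1) l - shift i l')

end Graded

/-!
Both parts of the theorem hold for any ideals `𝔪` and `I` of a Noetherian ring, once regularity is
read as regularity of the localization at the prime `𝔪`; locality and gradings of the resolutions
play no role.

*Stability.* Fix `n` and let `a` be a finite family of generators of `I`. Resolving the Rees algebra
of `I` by graded free modules over the polynomial ring `A = R[y]`, whose variables map to `a`, and
taking homogeneous parts of degree `k`, one obtains a resolution of `I ^ k` by projective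
`R`-modules. Thus all powers `I ^ k` have their `n`-th syzygies in one graded submodule `N` of a
graded free `A`-module `G` (`exists_graded_syzygies`). Comparison of resolutions shows that Artin–Rees
numbers may be computed from `N_k ≤ G_k`: two resolutions give stably equivalent syzygies, and this
relation preserves Artin–Rees numbers (`StablyEquivalent.ker`, `StablyEquivalent.artinReesSet_eq`).
The Artin–Rees lemma for `𝔪 A` and `N ≤ G` yields a bound valid in all degrees `k`. For each of the
finitely many powers `𝔪 ^ (i + 1)` below this bound, the failure of the inclusion
`N ∩ 𝔪 ^ (i + 1) G ⊆ 𝔪 (N ∩ 𝔪 ^ i G)` is measured by a finitely generated graded `A`-module, which is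
either zero in all large degrees or nonzero in all large degrees
(`IsShiftedHomogeneous.artinReesNumber_bounded_and_eventually_const`).

*Uniform bound.* As the previous step bounds `ρ_j (I ^ k)` for each fixed `j`, it remains to see that
the free modules of a minimal resolution vanish beyond a degree that does not depend on `k`. After
localizing at `𝔪` this is a statement on minimal exact complexes over a regular local ring
(`rank_eq_zero_of_minimal_exact`): killing a member of a regular system of parameters, which is a
nonzerodivisor because regular local rings are domains, costs one degree of exactness, and over the
residue field a minimal complex has zero differentials, so that exactness forces it to vanish.
-/

/-! ### Regular local rings are domains -/

open IsLocalRing in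
/-- Prime avoidance in a Noetherian local ring of positive dimension: some element of the maximal
ideal lies neither in its square nor in any minimal prime. -/
theorem exists_mem_maximalIdeal_notMem_sq_notMem_minimalPrimes {R : Type*} [CommRing R]
    [IsLocalRing R] [IsNoetherianRing R] (hdim : 1 ≤ ringKrullDim R) :
    ∃ x ∈ maximalIdeal R, x ∉ maximalIdeal R ^ 2 ∧ ∀ p ∈ minimalPrimes R, x ∉ p := by
  classical
  have hmin : ∀ p ∈ minimalPrimes R, ¬ maximalIdeal R ≤ p := by
    intro p hp hle
    have hpp : p.IsPrime := Ideal.IsMinimalPrime.isPrime hp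
    have heq : p = maximalIdeal R := le_antisymm (le_maximalIdeal hpp.ne_top) hle
    have h0 : (maximalIdeal R).height = 0 := by
      rw [Ideal.height_eq_zero_iff, ← heq]; exact hp
    rw [← maximalIdeal_height_eq_ringKrullDim, h0] at hdim
    exact absurd hdim (by decide)
  have hfin := minimalPrimes.finite_of_isNoetherianRing R
  by_contra! hcon
  have hsub : ((maximalIdeal R : Ideal R) : Set R) ⊆
      ⋃ i ∈ ((insert (maximalIdeal R ^ 2) hfin.toFinset : Finset (Ideal R)) : Set (Ideal R)),
        (id i : Ideal R) := by
    intro x hx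
    simp only [Finset.coe_insert, Set.Finite.coe_toFinset, Set.mem_insert_iff, id, Set.mem_iUnion,
      SetLike.mem_coe, exists_prop]
    by_cases h2 : x ∈ maximalIdeal R ^ 2
    · exact ⟨_, Or.inl rfl, h2⟩
    · obtain ⟨p, hp, hxp⟩ := hcon x hx h2
      exact ⟨p, Or.inr hp, hxp⟩
  rw [Ideal.subset_union_prime (maximalIdeal R ^ 2) (maximalIdeal R ^ 2)] at hsub
  · obtain ⟨i, hi, hle⟩ := hsub
    rw [Finset.mem_insert] at hi
    rcases hi with rfl | hi
    · have hbot : maximalIdeal R = ⊥ := by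
        refine Submodule.eq_bot_of_le_smul_of_le_jacobson_bot (maximalIdeal R) _
          (IsNoetherian.noetherian _) ?_ (maximalIdeal_le_jacobson _)
        simpa [pow_two] using hle
      obtain ⟨⟨p, hp⟩⟩ := Ideal.nonempty_minimalPrimes (I := (⊥ : Ideal R)) bot_ne_top
      exact hmin p hp (hbot ▸ bot_le)
    · exact hmin i (hfin.mem_toFinset.1 hi) hle
  · intro i hi hne _
    rw [Finset.mem_insert] at hi
    exact Ideal.IsMinimalPrime.isPrime (hfin.mem_toFinset.1 (hi.resolve_left hne))

open IsLocalRing in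
/-- An element outside the square of the maximal ideal can replace one of its generators, so that
modulo this element the maximal ideal needs one generator less. -/
theorem exists_span_range_maximalIdeal_quotient {R : Type*} [CommRing R] [IsLocalRing R] {d : ℕ}
    (v : Fin (d + 1) → R) (hv : Ideal.span (Set.range v) = maximalIdeal R) {x : R}
    (hx : x ∈ maximalIdeal R) (hx2 : x ∉ maximalIdeal R ^ 2) [IsLocalRing (R ⧸ Ideal.span {x})] :
    ∃ w : Fin d → R ⧸ Ideal.span {x}, Ideal.span (Set.range w) = maximalIdeal _ := by
  obtain ⟨a, ha⟩ := (Submodule.mem_span_range_iff_exists_fun R).1 (hv.symm ▸ hx : x ∈ Ideal.span _)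
  have hvm : ∀ j, v j ∈ maximalIdeal R := fun j => hv ▸ Ideal.subset_span ⟨j, rfl⟩
  obtain ⟨i, hi⟩ : ∃ i, IsUnit (a i) := by
    by_contra! hcon
    refine hx2 (ha ▸ Ideal.sum_mem _ fun j _ => ?_)
    rw [pow_two]
    exact Ideal.mul_mem_mul ((mem_maximalIdeal _).2 (hcon j)) (hvm j)
  let q := Ideal.Quotient.mk (Ideal.span {x})
  have hq : Function.Surjective q := Ideal.Quotient.mk_surjective
  refine ⟨fun j => q (v (i.succAbove j)), ?_⟩
  rw [← map_maximalIdeal_of_surjective q hq, ← hv, Ideal.map_span]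
  refine le_antisymm (Ideal.span_mono ?_) (Ideal.span_le.2 ?_)
  · rintro _ ⟨j, rfl⟩
    exact ⟨_, ⟨_, rfl⟩, rfl⟩
  · rintro _ ⟨_, ⟨j, rfl⟩, rfl⟩
    rcases Fin.eq_self_or_eq_succAbove i j with rfl | ⟨j, rfl⟩
    · have hsum : q (a j) * q (v j) + ∑ l, q (a (j.succAbove l)) * q (v (j.succAbove l)) = 0 := by
        have h0 : q (∑ l, a l • v l) = 0 := by
          rw [ha]
          exact Ideal.Quotient.eq_zero_iff_mem.2 (Ideal.mem_span_singleton_self x)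
        rw [map_sum, Fin.sum_univ_succAbove _ j] at h0
        simpa using h0
      have hmem : q (a j) * q (v j) ∈
          Ideal.span (Set.range fun l => q (v (j.succAbove l))) := by
        rw [eq_neg_of_add_eq_zero_left hsum]
        exact neg_mem (Ideal.sum_mem _ fun l _ =>
          Ideal.mul_mem_left _ _ (Ideal.subset_span ⟨l, rfl⟩))
      exact (Ideal.unit_mul_mem_iff_mem _ (hi.map q)).1 hmem
    · exact Ideal.subset_span ⟨j, rfl⟩

open IsLocalRing in
/-- The inductive step for regular local rings, in terms of a system of at most `dim R`
generators of the maximal ideal: killing a suitable element lowers their number by one. -/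
theorem exists_regular_quotient {R : Type*} [CommRing R] [IsLocalRing R] [IsNoetherianRing R]
    {d : ℕ} (v : Fin (d + 1) → R) (hv : Ideal.span (Set.range v) = maximalIdeal R)
    (hdim : ((d + 1 : ℕ) : WithBot ℕ∞) ≤ ringKrullDim R) :
    ∃ x ∈ maximalIdeal R, (∀ p ∈ minimalPrimes R, x ∉ p) ∧
      ∃ (_ : IsLocalRing (R ⧸ Ideal.span {x})) (w : Fin d → R ⧸ Ideal.span {x}),
        Ideal.span (Set.range w) = maximalIdeal _ ∧
        (d : WithBot ℕ∞) ≤ ringKrullDim (R ⧸ Ideal.span {x}) := by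
  have h1 : 1 ≤ ringKrullDim R := le_trans (by norm_cast; omega) hdim
  obtain ⟨x, hx, hx2, hxp⟩ := exists_mem_maximalIdeal_notMem_sq_notMem_minimalPrimes h1
  have : Nontrivial (R ⧸ Ideal.span {x}) := Ideal.Quotient.nontrivial_iff.2 fun h =>
    (maximalIdeal.isMaximal R).ne_top (top_le_iff.1 (h ▸ (Ideal.span_singleton_le_iff_mem _).2 hx))
  have hloc : IsLocalRing (R ⧸ Ideal.span {x}) :=
    .of_surjective' (Ideal.Quotient.mk _) Ideal.Quotient.mk_surjective
  obtain ⟨w, hw⟩ := exists_span_range_maximalIdeal_quotient v hv hx hx2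
  refine ⟨x, hx, hxp, hloc, w, hw, ?_⟩
  have h2 := hdim.trans (ringKrullDim_le_ringKrullDim_quotient_add_encard {x}
    (by simpa [ringJacobson_eq_maximalIdeal] using hx))
  rw [Set.encard_singleton] at h2
  push_cast at h2
  exact ENat.WithBot.add_le_add_one_right_iff.1 h2

open IsLocalRing in
/-- A Noetherian local ring whose maximal ideal is generated by `d ≤ dim R` elements is a domain. -/
theorem isDomain_of_span_range_eq_maximalIdeal (d : ℕ) {R : Type*} [CommRing R] [IsLocalRing R]
    [IsNoetherianRing R] (v : Fin d → R) (hv : Ideal.span (Set.range v) = maximalIdeal R)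
    (hdim : (d : WithBot ℕ∞) ≤ ringKrullDim R) : IsDomain R := by
  induction d generalizing R with
  | zero =>
    have hbot : maximalIdeal R = ⊥ := by rw [← hv]; simp
    exact (isField_iff_maximalIdeal_eq.2 hbot).isDomain
  | succ d ih =>
    obtain ⟨x, hx, hxp, hloc, w, hw, hwd⟩ := exists_regular_quotient v hv hdim
    have := ih w hw hwd
    have hprime : (Ideal.span {x}).IsPrime := (Ideal.Quotient.isDomain_iff_prime _).1 this
    obtain ⟨p, hp, hple⟩ := Ideal.exists_minimalPrimes_le (I := ⊥) (J := Ideal.span {x}) bot_le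
    have hpp : p.IsPrime := Ideal.IsMinimalPrime.isPrime hp
    -- Every element of `p ⊆ (x)` is `x` times an element of `p`, as `x ∉ p`.
    have hbot : p = ⊥ := by
      refine Submodule.eq_bot_of_le_smul_of_le_jacobson_bot (maximalIdeal R) _
        (IsNoetherian.noetherian _) ?_ (maximalIdeal_le_jacobson _)
      intro y hy
      obtain ⟨z, rfl⟩ := Ideal.mem_span_singleton.1 (hple hy)
      exact Submodule.smul_mem_smul hx ((hpp.mem_or_mem hy).resolve_left (hxp p hp))
    have : (⊥ : Ideal R).IsPrime := hbot ▸ hpp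
    exact IsDomain.of_bot_isPrime R

/-! ### Minimal complexes over regular local rings -/

/-- Modulo a nonzerodivisor `x`, a complex of free modules that is exact at `F (i + 1)` for `i ≥ s`
remains exact at `F (i + 1)` for `i ≥ s + 1`. -/
theorem exact_map_quotient_span_singleton {R : Type*} [CommRing R] {x : R}
    (hx : x ∈ nonZeroDivisors R) {r : ℕ → ℕ} (D : ∀ i, Matrix (Fin (r i)) (Fin (r (i + 1))) R)
    {s : ℕ} (hD : ∀ i, s ≤ i → ∀ v, (D i).mulVec v = 0 ↔ ∃ w, (D (i + 1)).mulVec w = v)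
    (i : ℕ) (hi : s + 1 ≤ i) (v : Fin (r (i + 1)) → R ⧸ Ideal.span {x}) :
    ((D i).map (Ideal.Quotient.mk (Ideal.span {x}))).mulVec v = 0 ↔
      ∃ w, ((D (i + 1)).map (Ideal.Quotient.mk (Ideal.span {x}))).mulVec w = v := by
  set q := Ideal.Quotient.mk (Ideal.span {x}) with hq
  have lift : ∀ {n : ℕ} (u : Fin n → R ⧸ Ideal.span {x}), ∃ u' : Fin n → R, q ∘ u' = u := by
    intro n u
    choose u' hu' using fun l => Ideal.Quotient.mk_surjective (u l)
    exact ⟨u', funext hu'⟩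
  have hmul : ∀ {m n : ℕ} (A : Matrix (Fin m) (Fin n) R) (u : Fin n → R),
      (A.map q).mulVec (q ∘ u) = q ∘ (A.mulVec u) := by
    intro m n A u
    funext l
    exact (RingHom.map_mulVec q A u l).symm
  constructor
  · intro hv
    obtain ⟨v, rfl⟩ := lift v
    rw [hmul] at hv
    have hdvd : ∀ l, ∃ c, (D i).mulVec v l = x * c := fun l =>
      Ideal.mem_span_singleton.1 (Ideal.Quotient.eq_zero_iff_mem.1 (congrFun hv l))
    choose c hc using hdvd
    obtain ⟨i, rfl⟩ : ∃ i', i = i' + 1 := ⟨i - 1, by omega⟩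
    have hc' : (D (i + 1)).mulVec v = x • c := funext hc
    have hc0 : (D i).mulVec c = 0 := by
      have h0 : x • (D i).mulVec c = 0 := by
        rw [← Matrix.mulVec_smul, ← hc']
        exact (hD i (by omega) _).2 ⟨v, rfl⟩
      funext l
      exact (mul_left_mem_nonZeroDivisors_eq_zero_iff hx).1 (congrFun h0 l)
    obtain ⟨b, hb⟩ := (hD i (by omega) _).1 hc0
    have : (D (i + 1)).mulVec (v - x • b) = 0 := by
      rw [Matrix.mulVec_sub, Matrix.mulVec_smul, hb, hc', sub_self]
    obtain ⟨w, hw⟩ := (hD (i + 1) (by omega) _).1 this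
    refine ⟨q ∘ w, ?_⟩
    rw [hmul, hw]
    funext l
    have h0 : q x = 0 := Ideal.Quotient.eq_zero_iff_mem.2 (Ideal.mem_span_singleton_self x)
    simp [h0]
  · rintro ⟨w, rfl⟩
    obtain ⟨w, rfl⟩ := lift w
    rw [hmul, hmul, (hD i (by omega) _).2 ⟨w, rfl⟩]
    funext l
    simp

open IsLocalRing in
/-- Over a Noetherian local ring whose maximal ideal is generated by `d ≤ dim R` elements, a minimal
complex of finite free modules that is exact from `F (s + 1)` on vanishes from degree `s + d + 1`
on. -/
theorem rank_eq_zero_of_minimal_exact (d : ℕ) {R : Type*} [CommRing R] [IsLocalRing R]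
    [IsNoetherianRing R] (v : Fin d → R) (hv : Ideal.span (Set.range v) = maximalIdeal R)
    (hdim : (d : WithBot ℕ∞) ≤ ringKrullDim R) {r : ℕ → ℕ}
    (D : ∀ i, Matrix (Fin (r i)) (Fin (r (i + 1))) R) (s : ℕ)
    (hD : ∀ i, s ≤ i → ∀ v, (D i).mulVec v = 0 ↔ ∃ w, (D (i + 1)).mulVec w = v)
    (hmin : ∀ i a b, D i a b ∈ maximalIdeal R) (n : ℕ) (hn : s + d + 1 ≤ n) : r n = 0 := by
  induction d generalizing R s with
  | zero =>
    have hbot : maximalIdeal R = ⊥ := by rw [← hv]; simp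
    have h0 : ∀ i, D i = 0 := fun i => by
      ext a b
      simpa [hbot] using hmin i a b
    obtain ⟨n, rfl⟩ : ∃ n', n = n' + 1 := ⟨n - 1, by omega⟩
    by_contra hr
    obtain ⟨w, hw⟩ := (hD n (by omega) 1).1 (by simp [h0])
    have := congrFun hw ⟨0, Nat.pos_of_ne_zero hr⟩
    simp [h0] at this
  | succ d ih =>
    have := isDomain_of_span_range_eq_maximalIdeal _ v hv hdim
    obtain ⟨x, hx, hxp, hloc, w, hw, hwd⟩ := exists_regular_quotient v hv hdim
    have hx0 : x ≠ 0 := fun h => hxp ⊥ (by rw [IsDomain.minimalPrimes_eq_singleton_bot]; rfl)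
      (h ▸ zero_mem _)
    refine ih w hw hwd (fun i => (D i).map (Ideal.Quotient.mk (Ideal.span {x}))) (s + 1)
      (exact_map_quotient_span_singleton (mem_nonZeroDivisors_of_ne_zero hx0) D hD) ?_ (by omega)
    intro i a b
    rw [← map_maximalIdeal_of_surjective _ Ideal.Quotient.mk_surjective]
    exact Ideal.mem_map_of_mem _ (hmin i a b)

/-- Localization at a prime ideal keeps complexes of finite free modules exact. -/
theorem exact_map_localization {R : Type*} [CommRing R] (p : Ideal R) [p.IsPrime] {r : ℕ → ℕ}
    (D : ∀ i, Matrix (Fin (r i)) (Fin (r (i + 1))) R)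
    (hD : ∀ i v, (D i).mulVec v = 0 ↔ ∃ w, (D (i + 1)).mulVec w = v)
    (i : ℕ) (v : Fin (r (i + 1)) → Localization.AtPrime p) :
    ((D i).map (algebraMap R (Localization.AtPrime p))).mulVec v = 0 ↔
      ∃ w, ((D (i + 1)).map (algebraMap R (Localization.AtPrime p))).mulVec w = v := by
  set q := algebraMap R (Localization.AtPrime p) with hq
  have hmul : ∀ {m n : ℕ} (A : Matrix (Fin m) (Fin n) R) (u : Fin n → R),
      (A.map q).mulVec (q ∘ u) = q ∘ (A.mulVec u) := by
    intro m n A u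
    funext l
    exact (RingHom.map_mulVec q A u l).symm
  have lift : ∀ {n : ℕ} (u : Fin n → Localization.AtPrime p),
      ∃ (t : p.primeCompl) (u' : Fin n → R), q ∘ u' = q t • u := by
    intro n u
    obtain ⟨t, ht⟩ := IsLocalization.exist_integer_multiples_of_finite p.primeCompl u
    choose u' hu' using ht
    refine ⟨t, u', funext fun l => ?_⟩
    simpa [Algebra.smul_def] using hu' l
  have hunit : ∀ t : p.primeCompl, IsUnit (q t) := IsLocalization.map_units _
  constructor
  · intro hv
    obtain ⟨t, v', hv'⟩ := lift v
    have h0 : ∀ l, ∃ c : p.primeCompl, (c : R) * (D i).mulVec v' l = 0 := by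
      intro l
      refine (IsLocalization.map_eq_zero_iff p.primeCompl (Localization.AtPrime p) _).1 ?_
      have := congrFun (hmul (D i) v') l
      rw [hv', Matrix.mulVec_smul, hv] at this
      simpa using this.symm
    choose c hc using h0
    let C : p.primeCompl := ∏ l, c l
    have hC : (D i).mulVec ((C : R) • v') = 0 := by
      rw [Matrix.mulVec_smul]
      funext l
      obtain ⟨e, he⟩ : c l ∣ C := Finset.dvd_prod_of_mem c (Finset.mem_univ l)
      simp only [Pi.smul_apply, smul_eq_mul, Pi.zero_apply]
      rw [he, Submonoid.coe_mul, mul_comm (c l : R), mul_assoc, hc, mul_zero]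
    obtain ⟨w, hw⟩ := (hD i _).1 hC
    obtain ⟨e, he⟩ := (hunit C).mul (hunit t)
    refine ⟨(↑e⁻¹ : Localization.AtPrime p) • (q ∘ w), ?_⟩
    rw [Matrix.mulVec_smul, hmul, hw]
    have : q ∘ ((C : R) • v') = (e : Localization.AtPrime p) • v := by
      rw [he, mul_smul, ← hv']
      funext l
      simp
    rw [this, smul_smul, Units.inv_mul, one_smul]
  · rintro ⟨w, rfl⟩
    obtain ⟨t, w', hw'⟩ := lift w
    have h := hmul (D (i + 1)) w'
    have h' := hmul (D i) ((D (i + 1)).mulVec w')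
    rw [(hD i _).2 ⟨w', rfl⟩, ← h, hw', Matrix.mulVec_smul, Matrix.mulVec_smul] at h'
    funext l
    have hl := congrFun h' l
    simp only [Pi.smul_apply, smul_eq_mul, Function.comp, Pi.zero_apply, map_zero] at hl
    exact (hunit t).mul_right_eq_zero.1 hl

/-- If the localization at the prime `𝔪` is regular, then there is a common bound for the degrees in
which minimal free resolutions with respect to `𝔪` are nonzero. -/
theorem exists_forall_rank_eq_zero {R : Type*} [CommRing R] (𝔪 : Ideal R) [𝔪.IsPrime]
    [IsRegularLocalRing (Localization.AtPrime 𝔪)] :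
    ∃ n₀ : ℕ, ∀ (M : Type*) [AddCommGroup M] [Module R M] (F : MinimalFreeResolution 𝔪 M) (n : ℕ),
      n₀ ≤ n → F.rank n = 0 := by
  set S := Localization.AtPrime 𝔪
  obtain ⟨g, hg, hspan⟩ := (IsNoetherian.noetherian
    (IsLocalRing.maximalIdeal S)).exists_span_finset_card_eq_spanFinrank
  refine ⟨g.card + 1, fun M _ _ F n hn => ?_⟩
  let D : ∀ i, Matrix (Fin (F.rank i)) (Fin (F.rank (i + 1))) R := fun i => LinearMap.toMatrix' (F.d i)
  have hDd : ∀ i v, (D i).mulVec v = F.d i v := fun i v => LinearMap.toMatrix'_mulVec _ _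
  refine rank_eq_zero_of_minimal_exact g.card (fun l => (g.equivFin.symm l : S)) ?_ ?_
    (fun i => (D i).map (algebraMap R S)) 0
    (fun i _ v => exact_map_localization 𝔪 D (fun i v => ?_) i v) ?_ n (by omega)
  · rw [← hspan]
    congr 1
    ext y
    constructor
    · rintro ⟨l, rfl⟩
      exact (g.equivFin.symm l).2
    · intro hy
      exact ⟨g.equivFin ⟨y, hy⟩, by simp⟩
  · rw [hg, IsRegularLocalRing.spanFinrank_maximalIdeal]
  · simp only [hDd]
    exact F.exact_d i v
  · intro i a b
    rw [← Localization.AtPrime.map_eq_maximalIdeal]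
    refine Ideal.mem_map_of_mem _ ?_
    have h1 := F.minimal i ⟨Pi.single b 1, rfl⟩
    have h2 := Submodule.mem_map_of_mem (f := (LinearMap.proj a : _ →ₗ[R] R)) h1
    rw [Submodule.map_smul''] at h2
    refine Submodule.smul_le.2 (fun c hc y _ => ?_) h2
    exact Ideal.mul_mem_right y _ hc

/-! ### Stable equivalence of submodules of projective modules -/

section StableEquivalence

variable {R P P' Q Q' : Type*} [CommRing R] [AddCommGroup P] [Module R P] [AddCommGroup P']
  [Module R P'] [AddCommGroup Q] [Module R Q] [AddCommGroup Q'] [Module R Q']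

/-- Two submodules `N ≤ P` and `N' ≤ P'` are stably equivalent if there are maps of pairs
`(P, N) → (P', N')` and back whose composites differ from the identity on `N` and on `N'` by maps
that extend to maps `P → N` and `P' → N'`. For syzygy modules inside the free modules of two
resolutions of the same module, these extensions come from a chain homotopy. -/
def StablyEquivalent (N : Submodule R P) (N' : Submodule R P') : Prop :=
  ∃ (f : P →ₗ[R] P') (g : P' →ₗ[R] P) (h : P →ₗ[R] P) (h' : P' →ₗ[R] P'),
    N ≤ N'.comap f ∧ N' ≤ N.comap g ∧ LinearMap.range h ≤ N ∧ LinearMap.range h' ≤ N' ∧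
    (∀ x ∈ N, g (f x) - x = h x) ∧ ∀ x ∈ N', f (g x) - x = h' x

theorem StablyEquivalent.symm {N : Submodule R P} {N' : Submodule R P'}
    (e : StablyEquivalent N N') : StablyEquivalent N' N := by
  obtain ⟨f, g, h, h', hf, hg, hh, hh', hgf, hfg⟩ := e
  exact ⟨g, f, h', h, hg, hf, hh', hh, hfg, hgf⟩

theorem map_pow_smul_inf_le (𝔪 : Ideal R) {N : Submodule R P} {N' : Submodule R P'}
    (f : P →ₗ[R] P') (hf : N ≤ N'.comap f) (a b : ℕ) :
    (𝔪 ^ a • (N ⊓ 𝔪 ^ b • (⊤ : Submodule R P))).map f ≤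
      𝔪 ^ a • (N' ⊓ 𝔪 ^ b • (⊤ : Submodule R P')) := by
  rw [Submodule.map_smul'']
  refine Submodule.smul_mono le_rfl (le_inf ?_ ?_)
  · exact (Submodule.map_mono inf_le_left).trans (Submodule.map_le_iff_le_comap.2 hf)
  · refine (Submodule.map_mono inf_le_right).trans ?_
    rw [Submodule.map_smul'']
    exact Submodule.smul_mono le_rfl le_top

theorem mem_artinReesSet_iff (𝔪 : Ideal R) (N : Submodule R P) (r : ℕ) :
    r ∈ artinReesSet 𝔪 N ↔ ∀ i, r ≤ i → N ⊓ 𝔪 ^ i • (⊤ : Submodule R P) ≤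
      𝔪 ^ (i - r) • (N ⊓ 𝔪 ^ r • (⊤ : Submodule R P)) := by
  refine forall₂_congr fun i hi => ⟨fun h => h.le, fun h => h.antisymm (le_inf ?_ ?_)⟩
  · exact Submodule.smul_le_right.trans inf_le_left
  · refine (Submodule.smul_mono le_rfl inf_le_right).trans ?_
    rw [← Submodule.mul_smul, ← pow_add, Nat.sub_add_cancel hi]

theorem StablyEquivalent.artinReesSet_le (𝔪 : Ideal R) {N : Submodule R P} {N' : Submodule R P'}
    (e : StablyEquivalent N N') : artinReesSet 𝔪 N' ⊆ artinReesSet 𝔪 N := by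
  obtain ⟨f, g, h, -, hf, hg, hh, -, hgf, -⟩ := e
  intro r hr
  rw [mem_artinReesSet_iff] at hr ⊢
  intro i hi z hz
  have h1 : f z ∈ N' ⊓ 𝔪 ^ i • (⊤ : Submodule R P') := by
    simpa using map_pow_smul_inf_le 𝔪 f hf 0 i (Submodule.mem_map_of_mem (by simpa using hz))
  have h2 := map_pow_smul_inf_le 𝔪 g hg _ _ (Submodule.mem_map_of_mem (hr i hi h1))
  have h3 : h z ∈ 𝔪 ^ (i - r) • (N ⊓ 𝔪 ^ r • (⊤ : Submodule R P)) := by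
    have h4 := Submodule.mem_map_of_mem (f := h) hz.2
    rw [Submodule.map_smul'', Submodule.map_top] at h4
    have h5 := Submodule.smul_mono (le_refl (𝔪 ^ i)) hh h4
    rw [← Nat.sub_add_cancel hi, pow_add, Submodule.mul_smul] at h5
    exact Submodule.smul_mono le_rfl
      (le_inf Submodule.smul_le_right (Submodule.smul_mono le_rfl le_top)) h5
  have h6 : z = g (f z) - h z := by rw [← hgf z hz.1, sub_sub_cancel]
  rw [h6]
  exact sub_mem h2 h3

/-- Stably equivalent submodules have the same Artin–Rees numbers. -/
theorem StablyEquivalent.artinReesSet_eq (𝔪 : Ideal R) {N : Submodule R P} {N' : Submodule R P'}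
    (e : StablyEquivalent N N') : artinReesSet 𝔪 N = artinReesSet 𝔪 N' :=
  (e.symm.artinReesSet_le 𝔪).antisymm (e.artinReesSet_le 𝔪)

theorem exists_comp_eq_of_range_le [Module.Projective R Q] (q : Q' →ₗ[R] P) (φ : Q →ₗ[R] P)
    (h : LinearMap.range φ ≤ LinearMap.range q) : ∃ ψ : Q →ₗ[R] Q', q ∘ₗ ψ = φ := by
  obtain ⟨ψ, hψ⟩ := Module.projective_lifting_property q.rangeRestrict
    (φ.codRestrict (LinearMap.range q) fun x => h ⟨x, rfl⟩) q.surjective_rangeRestrict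
  exact ⟨ψ, LinearMap.ext fun x => congrArg Subtype.val (LinearMap.congr_fun hψ x)⟩

/-- The common form of the first and of the later steps in comparing two resolutions: a comparison
of images lifts to a stable equivalence of kernels. -/
theorem StablyEquivalent.ker_of_homotopy [Module.Projective R Q] [Module.Projective R Q']
    (q : Q →ₗ[R] P) (q' : Q' →ₗ[R] P') (f : P →ₗ[R] P') (g : P' →ₗ[R] P) (h : P →ₗ[R] Q)
    (h' : P' →ₗ[R] Q') (hf : LinearMap.range q ≤ (LinearMap.range q').comap f)
    (hg : LinearMap.range q' ≤ (LinearMap.range q).comap g)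
    (hgf : ∀ x, g (f (q x)) - q x = q (h (q x))) (hfg : ∀ x, f (g (q' x)) - q' x = q' (h' (q' x))) :
    StablyEquivalent (LinearMap.ker q) (LinearMap.ker q') := by
  obtain ⟨F, hF⟩ := exists_comp_eq_of_range_le q' (f ∘ₗ q) (by rintro _ ⟨x, rfl⟩; exact hf ⟨x, rfl⟩)
  obtain ⟨G, hG⟩ := exists_comp_eq_of_range_le q (g ∘ₗ q') (by rintro _ ⟨x, rfl⟩; exact hg ⟨x, rfl⟩)
  replace hF : ∀ x, q' (F x) = f (q x) := LinearMap.congr_fun hF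
  replace hG : ∀ x, q (G x) = g (q' x) := LinearMap.congr_fun hG
  refine ⟨F, G, G ∘ₗ F - LinearMap.id - h ∘ₗ q, F ∘ₗ G - LinearMap.id - h' ∘ₗ q', ?_, ?_, ?_, ?_,
    ?_, ?_⟩
  · intro x hx
    simp [hF, LinearMap.mem_ker.1 hx]
  · intro x hx
    simp [hG, LinearMap.mem_ker.1 hx]
  · rintro _ ⟨x, rfl⟩
    simp [hF, hG, hgf]
  · rintro _ ⟨x, rfl⟩
    simp [hF, hG, hfg]
  · intro x hx
    simp [LinearMap.mem_ker.1 hx]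
  · intro x hx
    simp [LinearMap.mem_ker.1 hx]

/-- Two maps from projective modules with the same image have stably equivalent kernels. -/
theorem StablyEquivalent.ker_of_range_eq [Module.Projective R Q] [Module.Projective R Q']
    (q : Q →ₗ[R] P) (q' : Q' →ₗ[R] P) (h : LinearMap.range q = LinearMap.range q') :
    StablyEquivalent (LinearMap.ker q) (LinearMap.ker q') :=
  .ker_of_homotopy q q' .id .id 0 0 h.le h.ge (by simp) (by simp)

/-- Stable equivalence passes to the next syzygy modules. -/
theorem StablyEquivalent.ker [Module.Projective R P] [Module.Projective R P']
    [Module.Projective R Q] [Module.Projective R Q'] (q : Q →ₗ[R] P) (q' : Q' →ₗ[R] P')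
    (e : StablyEquivalent (LinearMap.range q) (LinearMap.range q')) :
    StablyEquivalent (LinearMap.ker q) (LinearMap.ker q') := by
  obtain ⟨f, g, h, h', hf, hg, hh, hh', hgf, hfg⟩ := e
  obtain ⟨H, hH⟩ := exists_comp_eq_of_range_le q h hh
  obtain ⟨H', hH'⟩ := exists_comp_eq_of_range_le q' h' hh'
  refine .ker_of_homotopy q q' f g H H' hf hg (fun x => ?_) fun x => ?_
  · rw [hgf _ ⟨x, rfl⟩, ← hH, LinearMap.comp_apply]
  · rw [hfg _ ⟨x, rfl⟩, ← hH', LinearMap.comp_apply]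

/-- A criterion for Artin–Rees numbers that compares consecutive degrees only. -/
theorem mem_artinReesSet_iff_succ (𝔪 : Ideal R) (N : Submodule R P) (r : ℕ) :
    r ∈ artinReesSet 𝔪 N ↔ ∀ i, r ≤ i → N ⊓ 𝔪 ^ (i + 1) • (⊤ : Submodule R P) ≤
      𝔪 • (N ⊓ 𝔪 ^ i • (⊤ : Submodule R P)) := by
  constructor
  · intro h i hi
    rw [h (i + 1) (by omega), h i hi, ← Submodule.mul_smul, ← pow_succ', Nat.sub_add_comm hi]
  · rw [mem_artinReesSet_iff]
    intro h i hi
    induction i, hi using Nat.le_induction with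
    | base => simp
    | succ i hi ih =>
      refine (h i hi).trans ?_
      rw [Nat.sub_add_comm hi, pow_succ', Submodule.mul_smul]
      exact Submodule.smul_mono le_rfl ih

end StableEquivalence

/-! ### Graded submodules of free modules over polynomial rings -/

section Graded

open MvPolynomial

variable {R σ ι κ : Type*} [CommRing R]

/-- The homogeneous component of degree `k` of an element of the graded free module
`⨁ l, R[σ](-e l)` over the standard graded polynomial ring `R[σ]`. -/
noncomputable def shiftedComponent (e : ι → ℕ) (k : ℕ) :
    (ι → MvPolynomial σ R) →ₗ[R] (ι → MvPolynomial σ R) :=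
  LinearMap.pi fun l => if e l ≤ k then homogeneousComponent (k - e l) ∘ₗ LinearMap.proj l else 0

theorem shiftedComponent_apply (e : ι → ℕ) (k : ℕ) (v : ι → MvPolynomial σ R) (l : ι) :
    shiftedComponent e k v l = if e l ≤ k then homogeneousComponent (k - e l) (v l) else 0 := by
  unfold shiftedComponent
  split_ifs with h <;> simp [h]

theorem shiftedComponent_zero_apply (k : ℕ) (v : ι → MvPolynomial σ R) (l : ι) :
    shiftedComponent 0 k v l = homogeneousComponent k (v l) := by
  simp [shiftedComponent_apply]

theorem homogeneousComponent_mul_of_isHomogeneous {p q : MvPolynomial σ R} {d : ℕ}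
    (hq : q.IsHomogeneous d) (k : ℕ) :
    homogeneousComponent k (p * q) = if d ≤ k then homogeneousComponent (k - d) p * q else 0 := by
  have hterm : ∀ i, homogeneousComponent k (homogeneousComponent i p * q) =
      if i + d = k then homogeneousComponent i p * q else 0 := fun i => by
    rw [homogeneousComponent_of_mem ((homogeneousComponent_isHomogeneous i p).mul hq)]
    exact if_congr eq_comm rfl rfl
  conv_lhs => rw [← sum_homogeneousComponent p, Finset.sum_mul, map_sum]
  rw [Finset.sum_congr rfl fun i _ => hterm i]
  by_cases hd : d ≤ k
  · rw [if_pos hd, Finset.sum_eq_single (k - d)]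
    · rw [if_pos (Nat.sub_add_cancel hd)]
    · intro i _ hi
      rw [if_neg (by omega)]
    · intro hi
      rw [Finset.mem_range] at hi
      rw [homogeneousComponent_eq_zero _ _ (by omega), zero_mul, ite_self]
  · rw [if_neg hd]
    exact Finset.sum_eq_zero fun i _ => if_neg (by omega)

theorem shiftedComponent_shiftedComponent (e : ι → ℕ) (k m : ℕ) (v : ι → MvPolynomial σ R) :
    shiftedComponent e k (shiftedComponent e m v) = if k = m then shiftedComponent e m v else 0 := by
  funext l
  rw [shiftedComponent_apply, shiftedComponent_apply]
  by_cases hkm : k = m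
  · subst hkm
    rw [if_pos rfl, shiftedComponent_apply]
    split_ifs
    · exact homogeneousComponent_eq_self (homogeneousComponent_isHomogeneous _ _)
    · rfl
  · rw [if_neg hkm, Pi.zero_apply]
    split_ifs
    · rw [homogeneousComponent_of_mem (homogeneousComponent_isHomogeneous _ _), if_neg (by omega)]
    · simp
    · rfl

theorem exists_sum_shiftedComponent [Finite ι] (e : ι → ℕ) (v : ι → MvPolynomial σ R) :
    ∃ n, ∑ k ∈ Finset.range n, shiftedComponent e k v = v := by
  have := Fintype.ofFinite ι
  refine ⟨(∑ l, (e l + (v l).totalDegree)) + 1, ?_⟩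
  funext l
  have hl : e l + (v l).totalDegree ≤ ∑ l, (e l + (v l).totalDegree) :=
    Finset.single_le_sum (f := fun l => e l + (v l).totalDegree) (fun _ _ => Nat.zero_le _)
      (Finset.mem_univ l)
  obtain ⟨t, ht⟩ := Nat.exists_eq_add_of_le hl
  rw [ht, Finset.sum_apply]
  simp only [shiftedComponent_apply]
  rw [show e l + (v l).totalDegree + t + 1 = e l + ((v l).totalDegree + 1 + t) by ring,
    Finset.sum_range_add, Finset.sum_eq_zero, zero_add, Finset.sum_range_add]
  · simp only [le_add_iff_nonneg_right, zero_le, if_true, Nat.add_sub_cancel_left]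
    rw [sum_homogeneousComponent, add_eq_left]
    refine Finset.sum_eq_zero fun i _ => ?_
    exact homogeneousComponent_eq_zero _ _ (by omega)
  · intro i hi
    rw [if_neg (by simpa using hi)]

theorem shiftedComponent_smul (e : ι → ℕ) {d : ℕ} {n : ι → MvPolynomial σ R}
    (hn : shiftedComponent e d n = n) (k : ℕ) (p : MvPolynomial σ R) :
    shiftedComponent e k (p • n) = if d ≤ k then homogeneousComponent (k - d) p • n else 0 := by
  have hl : ∀ l, n l = if e l ≤ d then homogeneousComponent (d - e l) (n l) else 0 := fun l => by
    rw [← shiftedComponent_apply, hn]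
  funext l
  rw [shiftedComponent_apply, Pi.smul_apply, smul_eq_mul]
  by_cases hd : e l ≤ d
  · have hh : (n l).IsHomogeneous (d - e l) := by
      rw [hl, if_pos hd]
      exact homogeneousComponent_isHomogeneous _ _
    rw [homogeneousComponent_mul_of_isHomogeneous hh]
    by_cases hk : d ≤ k
    · rw [if_pos hk, if_pos (by omega), if_pos (by omega), Pi.smul_apply, smul_eq_mul,
        show k - e l - (d - e l) = k - d by omega]
    · rw [if_neg hk]
      split_ifs
      · omega
      · rfl
      · rfl
  · have h0 : n l = 0 := by rw [hl, if_neg hd]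
    have : (if d ≤ k then homogeneousComponent (k - d) p • n else 0) l = 0 := by
      split_ifs <;> simp [h0]
    rw [this, h0, mul_zero, map_zero, ite_self]

/-- A submodule of a graded free module is graded if it contains the homogeneous components of its
elements. -/
def IsShiftedHomogeneous (e : ι → ℕ) (N : Submodule (MvPolynomial σ R) (ι → MvPolynomial σ R)) :
    Prop :=
  ∀ k, ∀ v ∈ N, shiftedComponent e k v ∈ N

/-- A map from a graded free module that sends the basis vectors to homogeneous elements of the
right degrees is homogeneous. -/
theorem shiftedComponent_linearCombination [Fintype κ] (e : ι → ℕ) (e' : κ → ℕ)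
    (n : κ → ι → MvPolynomial σ R) (hn : ∀ l, shiftedComponent e (e' l) (n l) = n l) (k : ℕ)
    (v : κ → MvPolynomial σ R) :
    shiftedComponent e k (Fintype.linearCombination (MvPolynomial σ R) n v) =
      Fintype.linearCombination (MvPolynomial σ R) n (shiftedComponent e' k v) := by
  rw [Fintype.linearCombination_apply, Fintype.linearCombination_apply, map_sum]
  refine Finset.sum_congr rfl fun l _ => ?_
  rw [shiftedComponent_smul e (hn l), shiftedComponent_apply]
  split_ifs <;> simp

theorem IsShiftedHomogeneous.exists_generators [IsNoetherianRing R] [Finite σ] [Finite ι]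
    {e : ι → ℕ} {N : Submodule (MvPolynomial σ R) (ι → MvPolynomial σ R)}
    (hN : IsShiftedHomogeneous e N) :
    ∃ (b : ℕ) (e' : Fin b → ℕ) (n : Fin b → ι → MvPolynomial σ R),
      (∀ l, shiftedComponent e (e' l) (n l) = n l) ∧
      Submodule.span (MvPolynomial σ R) (Set.range n) = N := by
  set s : Set (ι → MvPolynomial σ R) := {v | v ∈ N ∧ ∃ k, shiftedComponent e k v = v} with hs
  have hspan : Submodule.span (MvPolynomial σ R) s = N := by
    refine le_antisymm (Submodule.span_le.2 fun v hv => hv.1) fun v hv => ?_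
    obtain ⟨m, hm⟩ := exists_sum_shiftedComponent e v
    rw [← hm]
    refine sum_mem fun k _ => Submodule.subset_span ⟨hN k v hv, k, ?_⟩
    rw [shiftedComponent_shiftedComponent, if_pos rfl]
  obtain ⟨t, hts, ht⟩ := (Submodule.fg_span_iff_fg_span_finset_subset s).1
    (hspan ▸ IsNoetherian.noetherian N)
  choose d hd using fun v : t => (hts v.2).2
  refine ⟨t.card, fun l => d (t.equivFin.symm l), fun l => t.equivFin.symm l, fun l => hd _, ?_⟩
  rw [← hspan, ht]
  congr 1
  ext y
  constructor
  · rintro ⟨l, rfl⟩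
    exact (t.equivFin.symm l).2
  · intro hy
    exact ⟨t.equivFin ⟨y, hy⟩, by simp⟩

/-- A graded submodule `U` is generated in bounded degrees. So beyond this bound, if `U` is contained
in another submodule `V` in one degree, then also in the next. -/
theorem IsShiftedHomogeneous.exists_forall_le_succ [IsNoetherianRing R] [Finite σ] [Finite ι]
    {e : ι → ℕ} {U : Submodule (MvPolynomial σ R) (ι → MvPolynomial σ R)}
    (hU : IsShiftedHomogeneous e U) (V : Submodule (MvPolynomial σ R) (ι → MvPolynomial σ R)) :
    ∃ k₀, ∀ k, k₀ ≤ k → (∀ x ∈ U, shiftedComponent e k x = x → x ∈ V) →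
      ∀ x ∈ U, shiftedComponent e (k + 1) x = x → x ∈ V := by
  obtain ⟨b, e', n, hn, hspan⟩ := hU.exists_generators
  refine ⟨∑ l, e' l, fun k hk hUV x hx hxk => ?_⟩
  obtain ⟨v, rfl⟩ := (Submodule.mem_span_range_iff_exists_fun _).1 (hspan.symm ▸ hx)
  rw [← hxk, map_sum]
  refine sum_mem fun l _ => ?_
  have hl : e' l ≤ k :=
    (Finset.single_le_sum (f := e') (fun _ _ => Nat.zero_le _) (Finset.mem_univ l)).trans hk
  have hnU : n l ∈ U := hspan ▸ Submodule.subset_span ⟨l, rfl⟩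
  rw [shiftedComponent_smul e (hn l), if_pos (by omega)]
  set p := homogeneousComponent (k + 1 - e' l) (v l) with hp
  have hph : p.IsHomogeneous (k + 1 - e' l) := homogeneousComponent_isHomogeneous _ _
  rw [p.as_sum, Finset.sum_smul]
  refine sum_mem fun s hs => ?_
  -- Every monomial of `p` has positive degree, hence is a variable times a monomial that moves the
  -- generator `n l` into degree `k`.
  have hsd : s.degree = k + 1 - e' l := by
    have := hph (mem_support_iff.1 hs)
    rw [Finsupp.degree_eq_weight_one]
    exact this
  obtain ⟨c, hc⟩ : ∃ c, s c ≠ 0 := by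
    by_contra! h0
    have : s = 0 := Finsupp.ext h0
    rw [this, map_zero] at hsd
    omega
  obtain ⟨u, rfl⟩ : ∃ u, s = Finsupp.single c 1 + u :=
    ⟨s - Finsupp.single c 1, (add_tsub_cancel_of_le (by
      rw [Finsupp.single_le_iff]; exact Nat.one_le_iff_ne_zero.2 hc)).symm⟩
  have hud : u.degree = k - e' l := by
    rw [map_add, Finsupp.degree_single] at hsd
    omega
  have hmon : monomial (Finsupp.single c 1 + u) (coeff (Finsupp.single c 1 + u) p) =
      X c * monomial u (coeff (Finsupp.single c 1 + u) p) := by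
    rw [X, monomial_mul, one_mul]
  rw [hmon, mul_smul]
  refine V.smul_mem _ (hUV _ (U.smul_mem _ hnU) ?_)
  rw [shiftedComponent_smul e (hn l), if_pos hl, homogeneousComponent_eq_self]
  exact isHomogeneous_monomial _ hud

theorem IsShiftedHomogeneous.inf {e : ι → ℕ}
    {N N' : Submodule (MvPolynomial σ R) (ι → MvPolynomial σ R)}
    (hN : IsShiftedHomogeneous e N) (hN' : IsShiftedHomogeneous e N') :
    IsShiftedHomogeneous e (N ⊓ N') :=
  fun k v hv => ⟨hN k v hv.1, hN' k v hv.2⟩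

theorem IsShiftedHomogeneous.map_smul {e : ι → ℕ}
    {N : Submodule (MvPolynomial σ R) (ι → MvPolynomial σ R)} (hN : IsShiftedHomogeneous e N)
    (J : Ideal R) : IsShiftedHomogeneous e (J.map (algebraMap R (MvPolynomial σ R)) • N) := by
  intro k v hv
  rw [← Submodule.restrictScalars_mem R, Ideal.smul_restrictScalars] at hv ⊢
  have := Submodule.mem_map_of_mem (f := shiftedComponent e k) hv
  rw [Submodule.map_smul''] at this
  exact Submodule.smul_mono le_rfl (Submodule.map_le_iff_le_comap.2 (hN k)) this

/-- The homogeneous part of degree `k` of a graded free module over `R[σ]`, an `R`-module. -/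
noncomputable def degreePart (R σ : Type*) [CommRing R] (e : ι → ℕ) (k : ℕ) :
    Submodule R (ι → MvPolynomial σ R) :=
  LinearMap.range (shiftedComponent e k)

theorem mem_degreePart {e : ι → ℕ} {k : ℕ} {v : ι → MvPolynomial σ R} :
    v ∈ degreePart R σ e k ↔ shiftedComponent e k v = v := by
  constructor
  · rintro ⟨w, rfl⟩
    rw [shiftedComponent_shiftedComponent, if_pos rfl]
  · intro h
    exact ⟨v, h⟩

instance [Finite ι] (e : ι → ℕ) (k : ℕ) : Module.Projective R (degreePart R σ e k) :=
  .of_split (degreePart R σ e k).subtype (shiftedComponent e k).rangeRestrict <|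
    LinearMap.ext fun v => Subtype.ext (mem_degreePart.1 v.2)

/-- The homogeneous part of degree `k` of a submodule `N` of a graded free module, as a submodule of
the homogeneous part of degree `k` of the free module. -/
noncomputable def submoduleDegreePart (e : ι → ℕ) (k : ℕ)
    (N : Submodule (MvPolynomial σ R) (ι → MvPolynomial σ R)) : Submodule R (degreePart R σ e k) :=
  (N.restrictScalars R).comap (degreePart R σ e k).subtype

/-! ### Artin–Rees numbers of the graded pieces -/

theorem IsShiftedHomogeneous.coe_mem_pow_smul_iff {e : ι → ℕ} {k : ℕ}
    {N : Submodule (MvPolynomial σ R) (ι → MvPolynomial σ R)}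
    (hN : IsShiftedHomogeneous e N) (𝔪 : Ideal R) (a b : ℕ) (z : degreePart R σ e k) :
    z ∈ 𝔪 ^ a • (submoduleDegreePart e k N ⊓ 𝔪 ^ b • (⊤ : Submodule R (degreePart R σ e k))) ↔
      (z : ι → MvPolynomial σ R) ∈ 𝔪 ^ a • (N.restrictScalars R ⊓ 𝔪 ^ b • ⊤) := by
  constructor
  · intro hz
    exact map_pow_smul_inf_le 𝔪 (degreePart R σ e k).subtype le_rfl a b
      (Submodule.mem_map_of_mem hz)
  · intro hz
    have := map_pow_smul_inf_le 𝔪 (N' := submoduleDegreePart e k N)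
      (shiftedComponent e k).rangeRestrict (fun v hv => hN k v hv) a b
      (Submodule.mem_map_of_mem hz)
    have hz' : (shiftedComponent e k).rangeRestrict (z : ι → MvPolynomial σ R) = z :=
      Subtype.ext (mem_degreePart.1 z.2)
    exact (congrArg (fun y => y ∈ 𝔪 ^ a • (submoduleDegreePart e k N ⊓ 𝔪 ^ b • ⊤)) hz').mp this

/-- The Artin–Rees numbers of the graded pieces of a graded submodule `N` are bounded, by the
Artin–Rees lemma over the polynomial ring. They stabilize since the failure of the Artin–Rees
equality in a fixed power of `𝔪` is measured by a finitely generated graded module. -/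
theorem IsShiftedHomogeneous.artinReesNumber_bounded_and_eventually_const [IsNoetherianRing R]
    [Finite σ] [Finite ι] {e : ι → ℕ}
    {N : Submodule (MvPolynomial σ R) (ι → MvPolynomial σ R)} (hN : IsShiftedHomogeneous e N)
    (𝔪 : Ideal R) :
    (∃ c, ∀ k, artinReesNumber 𝔪 (submoduleDegreePart e k N) ≤ c) ∧
      ∃ c k₀, ∀ k, k₀ ≤ k → artinReesNumber 𝔪 (submoduleDegreePart e k N) = c := by
  set m' := 𝔪.map (algebraMap R (MvPolynomial σ R)) with hm'
  let D : ℕ → ℕ → Prop := fun i k =>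
    ∀ x ∈ N ⊓ m' ^ (i + 1) • (⊤ : Submodule (MvPolynomial σ R) (ι → MvPolynomial σ R)),
      shiftedComponent e k x = x → x ∈ m' • (N ⊓ m' ^ i • (⊤ : Submodule _ _))
  have hDmem : ∀ r k, r ∈ artinReesSet 𝔪 (submoduleDegreePart e k N) ↔ ∀ i, r ≤ i → D i k := by
    intro r k
    rw [mem_artinReesSet_iff_succ]
    refine forall₂_congr fun i _ => ?_
    have h1 : ∀ z : degreePart R σ e k, z ∈ submoduleDegreePart e k N ⊓ 𝔪 ^ (i + 1) •
        (⊤ : Submodule R (degreePart R σ e k)) ↔ (z : ι → MvPolynomial σ R) ∈ N ⊓ m' ^ (i + 1) • ⊤ := by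
      intro z
      have := hN.coe_mem_pow_smul_iff (k := k) 𝔪 0 (i + 1) z
      rw [pow_zero, Ideal.one_eq_top, Submodule.top_smul, Submodule.top_smul] at this
      rw [this, ← Submodule.restrictScalars_mem R (N ⊓ _), Submodule.restrictScalars_inf, hm',
        ← Ideal.map_pow, Ideal.smul_restrictScalars, Submodule.restrictScalars_top]
    have h2 : ∀ z : degreePart R σ e k, z ∈ 𝔪 • (submoduleDegreePart e k N ⊓ 𝔪 ^ i •
        (⊤ : Submodule R (degreePart R σ e k))) ↔
        (z : ι → MvPolynomial σ R) ∈ m' • (N ⊓ m' ^ i • (⊤ : Submodule _ _)) := by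
      intro z
      have := hN.coe_mem_pow_smul_iff (k := k) 𝔪 1 i z
      rw [pow_one] at this
      rw [this, ← Submodule.restrictScalars_mem R (m' • _), hm', Ideal.smul_restrictScalars,
        Submodule.restrictScalars_inf, ← Ideal.map_pow, Ideal.smul_restrictScalars,
        Submodule.restrictScalars_top]
    constructor
    · intro h x hx hxk
      exact (h2 ⟨x, mem_degreePart.2 hxk⟩).1 (h ((h1 ⟨x, mem_degreePart.2 hxk⟩).2 hx))
    · intro h z hz
      exact (h2 z).2 (h z ((h1 z).1 hz) (mem_degreePart.1 z.2))
  have htop : IsShiftedHomogeneous e (⊤ : Submodule (MvPolynomial σ R) (ι → MvPolynomial σ R)) :=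
    fun _ _ _ => trivial
  have hDsucc : ∀ i, ∃ k₀, ∀ k, k₀ ≤ k → D i k → D i (k + 1) := fun i => by
    refine (hN.inf ?_).exists_forall_le_succ _
    rw [hm', ← Ideal.map_pow]
    exact htop.map_smul _
  have hDconst : ∀ i, ∃ k₀, ∀ k, k₀ ≤ k → (D i k ↔ D i k₀) := by
    intro i
    obtain ⟨k₀, hk₀⟩ := hDsucc i
    have hmono : ∀ k l, k₀ ≤ k → k ≤ l → D i k → D i l := by
      intro k l hk hl h
      induction l, hl using Nat.le_induction with
      | base => exact h
      | succ l hl ih => exact hk₀ l (hk.trans hl) ih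
    by_cases hex : ∃ k, k₀ ≤ k ∧ D i k
    · obtain ⟨k₁, hk₁, h⟩ := hex
      exact ⟨k₁, fun k hk => ⟨fun _ => h, fun _ => hmono _ _ hk₁ hk h⟩⟩
    · refine ⟨k₀, fun k hk => ⟨fun h => absurd ⟨k, hk, h⟩ hex, fun h => hmono _ _ le_rfl hk h⟩⟩
  -- The Artin–Rees lemma over `R[σ]` settles all degrees at once for powers beyond `r₀`.
  have hr₀ := (isLeast_artinReesNumber m' N).1
  set r₀ := artinReesNumber m' N
  rw [mem_artinReesSet_iff_succ] at hr₀
  have hD₀ : ∀ i, r₀ ≤ i → ∀ k, D i k := fun i hi k x hx _ => hr₀ i hi hx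
  refine ⟨⟨r₀, fun k => Nat.sInf_le ((hDmem _ _).2 fun i hi => hD₀ i hi k)⟩, ?_⟩
  choose K hK using hDconst
  set k₀ := ∑ i ∈ Finset.range r₀, K i
  refine ⟨artinReesNumber 𝔪 (submoduleDegreePart e k₀ N), k₀, fun k hk => ?_⟩
  unfold artinReesNumber
  congr 1
  ext r
  rw [hDmem, hDmem]
  refine forall₂_congr fun i _ => ?_
  by_cases hi : r₀ ≤ i
  · exact iff_of_true (hD₀ i hi _) (hD₀ i hi _)
  · have hKi : K i ≤ k₀ := Finset.single_le_sum (f := K) (fun _ _ => Nat.zero_le _)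
      (Finset.mem_range.2 (not_le.1 hi))
    rw [hK i k (hKi.trans hk), hK i k₀ hKi]

end Graded

/-! ### Graded syzygies of the powers of an ideal -/

section Powers

open MvPolynomial

variable {R : Type*} [CommRing R]

/-- The defining relations of the Rees algebra of the ideal generated by a family `a`, as a submodule
of a graded free module of rank one: the polynomials whose homogeneous components vanish at `a`. -/
noncomputable def reesRelations {c : ℕ} (a : Fin c → R) :
    Submodule (MvPolynomial (Fin c) R) (Fin 1 → MvPolynomial (Fin c) R) where
  carrier := {v | ∀ k, eval a (homogeneousComponent k (v 0)) = 0}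
  add_mem' {v w} hv hw k := by
    simp only [Set.mem_ofPred_eq] at hv hw
    rw [Pi.add_apply, map_add, map_add, hv, hw, add_zero]
  zero_mem' k := by simp
  smul_mem' p v hv k := by
    simp only [Set.mem_ofPred_eq] at hv
    rw [Pi.smul_apply, smul_eq_mul]
    conv_lhs => rw [← sum_homogeneousComponent p, Finset.sum_mul, map_sum, map_sum]
    refine Finset.sum_eq_zero fun i _ => ?_
    rw [mul_comm, homogeneousComponent_mul_of_isHomogeneous (homogeneousComponent_isHomogeneous i p)]
    split_ifs
    · rw [map_mul, hv, zero_mul]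
    · rw [map_zero]

theorem isShiftedHomogeneous_reesRelations {c : ℕ} (a : Fin c → R) :
    IsShiftedHomogeneous 0 (reesRelations a) := by
  intro k v hv m
  rw [shiftedComponent_zero_apply,
    homogeneousComponent_of_mem (homogeneousComponent_isHomogeneous _ _)]
  split_ifs
  · exact hv _
  · rw [map_zero]

/-- For each `n`, the `(n + 1)`-st syzygies of all powers of an ideal are, up to stable equivalence,
the homogeneous parts of one graded submodule of a graded free module over a polynomial ring. -/
theorem exists_graded_syzygies [IsNoetherianRing R] (𝔪 I : Ideal R) {c : ℕ} (a : Fin c → R)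
    (ha : Ideal.span (Set.range a) = I) (n : ℕ) :
    ∃ (b : ℕ) (e : Fin b → ℕ)
      (N : Submodule (MvPolynomial (Fin c) R) (Fin b → MvPolynomial (Fin c) R)),
      IsShiftedHomogeneous e N ∧ ∀ (k : ℕ) (F : MinimalFreeResolution 𝔪 ↥(I ^ k)),
        StablyEquivalent (LinearMap.range (F.d n)) (submoduleDegreePart e k N) := by
  induction n with
  | zero =>
    refine ⟨1, 0, reesRelations a, isShiftedHomogeneous_reesRelations a, fun k F => ?_⟩
    have hhom : ∀ v : degreePart R (Fin c) (0 : Fin 1 → ℕ) k,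
        homogeneousComponent k ((v : Fin 1 → MvPolynomial (Fin c) R) 0) =
          (v : Fin 1 → MvPolynomial (Fin c) R) 0 := by
      intro v
      have := congrFun (mem_degreePart.1 v.2) 0
      rwa [shiftedComponent_zero_apply] at this
    let π : degreePart R (Fin c) (0 : Fin 1 → ℕ) k →ₗ[R] R :=
      (aeval a).toLinearMap ∘ₗ LinearMap.proj 0 ∘ₗ (degreePart R (Fin c) 0 k).subtype
    have hπ : ∀ v, π v = eval a ((v : Fin 1 → MvPolynomial (Fin c) R) 0) := fun v =>
      congrFun (congrArg DFunLike.coe (coe_aeval_eq_eval a)) _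
    have hker : LinearMap.ker π = submoduleDegreePart 0 k (reesRelations a) := by
      ext v
      rw [LinearMap.mem_ker, hπ]
      constructor
      · intro hv m
        change eval a (homogeneousComponent m ((v : Fin 1 → MvPolynomial (Fin c) R) 0)) = 0
        rw [← hhom, homogeneousComponent_of_mem (homogeneousComponent_isHomogeneous _ _), hhom]
        split_ifs
        · exact hv
        · rw [map_zero]
      · intro hv
        rw [← hhom]
        exact hv k
    have hker' : LinearMap.ker ((I ^ k).subtype ∘ₗ F.aug) = LinearMap.range (F.d 0) := by
      rw [LinearMap.ker_comp, Submodule.ker_subtype, ← LinearMap.ker]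
      exact LinearMap.exact_iff.1 F.exact_aug
    rw [← hker, ← hker']
    refine .ker_of_range_eq _ _ ?_
    rw [LinearMap.range_comp, LinearMap.range_eq_top.2 F.aug_surjective, Submodule.map_top,
      Submodule.range_subtype]
    ext x
    rw [← ha, Ideal.mem_span_pow_iff_exists_isHomogeneous]
    constructor
    · rintro ⟨p, hp, rfl⟩
      refine ⟨⟨fun _ => p, mem_degreePart.2 (funext fun l => ?_)⟩, hπ _⟩
      rw [shiftedComponent_zero_apply]
      exact homogeneousComponent_eq_self hp
    · rintro ⟨v, rfl⟩
      refine ⟨(v : Fin 1 → MvPolynomial (Fin c) R) 0, ?_, (hπ v).symm⟩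
      rw [← hhom]
      exact homogeneousComponent_isHomogeneous _ _
  | succ n ih =>
    obtain ⟨b, e, N, hN, hF⟩ := ih
    obtain ⟨b', e', g, hg, hspan⟩ := hN.exists_generators
    set q := Fintype.linearCombination (MvPolynomial (Fin c) R) g with hq
    have hqc := shiftedComponent_linearCombination e e' g hg
    have hqr : LinearMap.range q = N := by rw [hq, Fintype.range_linearCombination, hspan]
    refine ⟨b', e', LinearMap.ker q, fun k v hv => ?_, fun k F => ?_⟩
    · rw [LinearMap.mem_ker] at hv ⊢
      rw [hq, ← hqc, ← hq, hv, map_zero]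
    · let qk : degreePart R (Fin c) e' k →ₗ[R] degreePart R (Fin c) e k :=
        (q.restrictScalars R).restrict fun v hv => mem_degreePart.2 <| by
          rw [LinearMap.restrictScalars_apply, hq, hqc, mem_degreePart.1 hv]
      have hker : LinearMap.ker qk = submoduleDegreePart e' k (LinearMap.ker q) := by
        ext v
        exact Subtype.ext_iff
      have hrange : LinearMap.range qk = submoduleDegreePart e k N := by
        ext v
        constructor
        · rintro ⟨w, rfl⟩
          exact hqr.le ⟨w, rfl⟩
        · intro hv
          obtain ⟨w, hw⟩ := hqr.ge hv
          refine ⟨⟨shiftedComponent e' k w, w, rfl⟩, Subtype.ext ?_⟩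
          change q (shiftedComponent e' k w) = v
          rw [hq, ← hqc, ← hq, hw]
          exact mem_degreePart.1 v.2
      have hFker : LinearMap.ker (F.d n) = LinearMap.range (F.d (n + 1)) :=
        LinearMap.exact_iff.1 (F.exact_d n)
      rw [← hFker, ← hker]
      refine StablyEquivalent.ker _ _ ?_
      rw [hrange]
      exact hF k F

/-- Over a Noetherian ring, the Artin–Rees numbers of the `j`-th syzygies of the powers `I ^ k` are
bounded and eventually constant. Neither locality nor a grading is needed for this. -/
theorem rho_pow_bounded_and_eventually_const [IsNoetherianRing R] (𝔪 I : Ideal R) {j : ℕ}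
    (hj : 1 ≤ j) :
    (∃ c, ∀ k, ∀ F : MinimalFreeResolution 𝔪 ↥(I ^ k), F.rho j ≤ c) ∧
      ∃ c k₀ : ℕ, ∀ k, k₀ ≤ k → ∀ F : MinimalFreeResolution 𝔪 ↥(I ^ k), F.rho j = c := by
  obtain ⟨n, rfl⟩ : ∃ n, j = n + 1 := ⟨j - 1, by omega⟩
  obtain ⟨c, a, ha⟩ := Submodule.fg_iff_exists_fin_generating_family.1 (IsNoetherian.noetherian I)
  obtain ⟨b, e, N, hN, hF⟩ := exists_graded_syzygies 𝔪 I a ha n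
  have hrho : ∀ k (F : MinimalFreeResolution 𝔪 ↥(I ^ k)),
      F.rho (n + 1) = artinReesNumber 𝔪 (submoduleDegreePart e k N) := fun k F =>
    congrArg sInf ((hF k F).artinReesSet_eq 𝔪)
  obtain ⟨⟨r, hr⟩, r', k₀, hk₀⟩ := hN.artinReesNumber_bounded_and_eventually_const 𝔪
  exact ⟨⟨r, fun k F => (hrho k F).trans_le (hr k)⟩, r', k₀,
    fun k hk F => (hrho k F).trans (hk₀ k hk)⟩

/-- If the localization at the prime `𝔪` is regular, the Artin–Rees numbers of all syzygies of all
powers of an ideal have a common bound, since the syzygies of large order vanish. -/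
theorem rho_pow_bounded_of_regular [IsNoetherianRing R] (𝔪 I : Ideal R) [𝔪.IsPrime]
    [IsRegularLocalRing (Localization.AtPrime 𝔪)] :
    ∃ c, ∀ j, 1 ≤ j → ∀ k, ∀ F : MinimalFreeResolution 𝔪 ↥(I ^ k), F.rho j ≤ c := by
  obtain ⟨n₀, hn₀⟩ := exists_forall_rank_eq_zero 𝔪
  have hb : ∀ j, ∃ c, 1 ≤ j → ∀ k, ∀ F : MinimalFreeResolution 𝔪 ↥(I ^ k), F.rho j ≤ c := by
    intro j
    by_cases hj : 1 ≤ j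
    · obtain ⟨c, hc⟩ := (rho_pow_bounded_and_eventually_const 𝔪 I hj).1
      exact ⟨c, fun _ => hc⟩
    · exact ⟨0, fun h => absurd h hj⟩
  choose C hC using hb
  refine ⟨∑ j ∈ Finset.range (n₀ + 1), C j, fun j hj k F => ?_⟩
  by_cases hjn : j < n₀ + 1
  · exact (hC j hj k F).trans (Finset.single_le_sum (f := C) (fun _ _ => Nat.zero_le _)
      (Finset.mem_range.2 hjn))
  · have h0 : F.rank (j - 1) = 0 := hn₀ _ F _ (by omega)
    have hsub : Subsingleton (Fin (F.rank (j - 1)) → R) := by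
      rw [h0]
      infer_instance
    have : F.rho j ≤ 0 := Nat.sInf_le fun i _ => Subsingleton.elim _ _
    exact this.trans (Nat.zero_le _)

end Powers

/-! ### Standard graded algebras -/

theorem IsStandardGraded.isNoetherianRing {K R : Type*} [Field K] [CommRing R] [Algebra K R]
    {𝒜 : ℕ → Submodule K R} [GradedAlgebra 𝒜] (h : IsStandardGraded 𝒜) : IsNoetherianRing R := by
  obtain ⟨s, hs⟩ := (Submodule.fg_iff_finiteDimensional _).2 h.finite
  have : Algebra.FiniteType K R := by
    refine ⟨s, ?_⟩
    rw [← top_le_iff, ← h.generated, ← hs]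
    exact Algebra.adjoin_le (Algebra.span_le_adjoin K _)
  exact Algebra.FiniteType.isNoetherianRing K R

theorem IsStandardGraded.isPrime_irrelevant {K R : Type*} [Field K] [CommRing R] [Algebra K R]
    {𝒜 : ℕ → Submodule K R} [GradedAlgebra 𝒜] (h : IsStandardGraded 𝒜) :
    (HomogeneousIdeal.irrelevant 𝒜).toIdeal.IsPrime := by
  have := h.nontrivial
  have hK : ∀ x, ∃ a : K, algebraMap K R a = GradedRing.projZeroRingHom 𝒜 x := by
    intro x
    have hx : GradedRing.projZeroRingHom 𝒜 x ∈ 𝒜 0 := by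
      rw [GradedRing.projZeroRingHom_apply]
      exact SetLike.coe_mem _
    rw [h.degree_zero] at hx
    exact Submodule.mem_one.1 hx
  have hmem : ∀ x, x ∈ (HomogeneousIdeal.irrelevant 𝒜).toIdeal ↔
      GradedRing.projZeroRingHom 𝒜 x = 0 := fun x => Iff.rfl
  refine ⟨fun htop => ?_, fun {x y} hxy => ?_⟩
  · have := (hmem 1).1 (htop ▸ trivial)
    rw [map_one] at this
    exact one_ne_zero this
  · rw [hmem, map_mul] at hxy
    obtain ⟨a, ha⟩ := hK x
    obtain ⟨b, hb⟩ := hK y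
    rw [hmem, hmem, ← ha, ← hb]
    rw [← ha, ← hb, ← map_mul, map_eq_zero, mul_eq_zero] at hxy
    exact hxy.imp (fun h => by rw [h, map_zero]) fun h => by rw [h, map_zero]

theorem theorem3p4 :
    -- the case of a Noetherian local ring
    (∀ {R : Type*} [CommRing R] [IsLocalRing R] [IsNoetherianRing R]
        (I : Ideal R), I ≤ IsLocalRing.maximalIdeal R →
      (∀ j : ℕ, 1 ≤ j → ∃ c k₀ : ℕ, ∀ k : ℕ, k₀ ≤ k →
        ∀ F : MinimalFreeResolution (IsLocalRing.maximalIdeal R) ↥(I ^ k), F.rho j = c) ∧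
      (IsRegularLocalRing R → ∃ c : ℕ, ∀ j : ℕ, 1 ≤ j → ∀ k : ℕ,
        ∀ F : MinimalFreeResolution (IsLocalRing.maximalIdeal R) ↥(I ^ k), F.rho j ≤ c)) ∧
    -- the case of a standard graded algebra over a field
    (∀ {K R : Type*} [Field K] [CommRing R] [Algebra K R]
        (𝒜 : ℕ → Submodule K R) [GradedAlgebra 𝒜], IsStandardGraded 𝒜 →
      ∀ I : Ideal R, I.IsHomogeneous 𝒜 → I ≤ (HomogeneousIdeal.irrelevant 𝒜).toIdeal →
      (∀ j : ℕ, 1 ≤ j → ∃ c k₀ : ℕ, ∀ k : ℕ, k₀ ≤ k →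
        ∀ F : MinimalFreeResolution (HomogeneousIdeal.irrelevant 𝒜).toIdeal ↥(I ^ k),
          F.IsGraded 𝒜 → F.rho j = c) ∧
      (IsRegularRing R → ∃ c : ℕ, ∀ j : ℕ, 1 ≤ j → ∀ k : ℕ,
        ∀ F : MinimalFreeResolution (HomogeneousIdeal.irrelevant 𝒜).toIdeal ↥(I ^ k),
          F.IsGraded 𝒜 → F.rho j ≤ c)) := by

  refine ⟨fun {R} _ _ _ I _ => ⟨fun j hj => (rho_pow_bounded_and_eventually_const _ I hj).2,
    fun hreg => ?_⟩, fun {K R} _ _ _ 𝒜 _ h𝒜 I _ _ => ?_⟩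
  · -- A local ring is its own localization at the maximal ideal.
    let e : R ≃ₐ[R] Localization.AtPrime (IsLocalRing.maximalIdeal R) :=
      IsLocalization.atUnits R (IsLocalRing.maximalIdeal R).primeCompl
        (fun x hx => IsLocalRing.notMem_maximalIdeal.1 hx)
    have := IsRegularLocalRing.of_ringEquiv e.toRingEquiv
    exact rho_pow_bounded_of_regular _ I
  · have := h𝒜.isNoetherianRing
    have := h𝒜.isPrime_irrelevant
    refine ⟨fun j hj => ?_, fun hreg => ?_⟩
    · obtain ⟨c, k₀, hc⟩ := (rho_pow_bounded_and_eventually_const _ I hj).2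
      exact ⟨c, k₀, fun k hk F _ => hc k hk F⟩
    · obtain ⟨c, hc⟩ := rho_pow_bounded_of_regular (HomogeneousIdeal.irrelevant 𝒜).toIdeal I
      exact ⟨c, fun j hj k F _ => hc j hj k F⟩
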